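/- Let $R$ be a commutative Noetherian ring, $M$ a finitely generated $R$-module, $N\subseteq M$ a submodule, and $\mathfrak p$ an embedded associated prime of $N$, i.e. $\mathfrak p\in\mathrm{Ass}_R(M/N)$ and $\mathfrak p$ is not minimal in $\mathrm{Ass}_R(M/N)$. A proper submodule of $M$ is irreducible if it is not the intersection of two strictly larger submodules; a finite decomposition of a submodule as an intersection of irreducible submodules is irredundant if no member can be omitted. An irredundant primary decomposition is a finite one in which no member can be omitted and the members belong to pairwise distinct primes. A $\mathfrak p$-maximal embedded component of $N$ is a maximal element, with respect to inclusion, of the set of all $\mathfrak p$-primary submodules of $M$ that appear in some irredundant primary decomposition of $N$. For a submodule $L$ of $M$, let $\mathrm{IC}_{\mathfrak p}(L)$ be the set of all irreducible $\mathfrak p$-primary submodules of $M$ that appear in some irredundant irreducible decomposition of $L$, and let $\mathrm{ir}_{\mathfrak p}(L)$ be the number of $\mathfrak p$-primary members of an irredundant irreducible decomposition of $L$. Let $k(\mathfrak p)=R_{\mathfrak p}/\mathfrak pR_{\mathfrak p}$, and let $\mathrm{Soc}$ denote the socle of an $R_{\mathfrak p}$-module, the sum of its simple submodules. Then for $L=N$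 and for $L$ any $\mathfrak p$-maximal embedded component of $N$, the number $\mathrm{ir}_{\mathfrak p}(L)$ does not depend on the chosen irredundant irreducible decomposition of $L$, and: (i) for every $\mathfrak p$-maximal embedded component $Q$ of $N$, $$\mathrm{ir}_{\mathfrak p}(N)=\mathrm{ir}_{\mathfrak p}(Q)=\dim_{k(\mathfrak p)}\mathrm{Soc}\big((M/N)_{\mathfrak p}\big);$$ (ii) $\mathrm{IC}_{\mathfrak p}(N)=\bigcup_Q \mathrm{IC}_{\mathfrak p}(Q)$, where $Q$ runs over all $\mathfrak p$-maximal embedded components of $N$. -/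

import Mathlib

namespace IndexOfReducibility

/-- The socle of a module: the sum of all its simple submodules. -/
def socle (A L : Type*) [CommRing A] [AddCommGroup L] [Module A L] : Submodule A L :=
  sSup {S : Submodule A L | IsSimpleModule A S}

/-- Over a local ring the maximal ideal annihilates the socle. -/
theorem socle_isTorsionBySet (A L : Type*) [CommRing A] [IsLocalRing A] [AddCommGroup L]
    [Module A L] :
    Module.IsTorsionBySet A (socle A L) (IsLocalRing.maximalIdeal A : Set A) := by
  have key : socle A L ≤ Submodule.torsionBySet A L (IsLocalRing.maximalIdeal A : Set A) := by
    refine sSup_le fun S hS x hx => ?_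
    have hS' : IsSimpleModule A S := hS
    have hmax : (Module.annihilator A S).IsMaximal := IsSimpleModule.annihilator_isMaximal
    rw [Submodule.mem_torsionBySet_iff]
    rintro ⟨a, ha⟩
    rw [← IsLocalRing.eq_maximalIdeal hmax] at ha
    exact congrArg Subtype.val (Module.mem_annihilator.mp ha ⟨x, hx⟩)
  intro x a
  exact Subtype.ext ((Submodule.mem_torsionBySet_iff _ _).mp (key x.2) a)

/-- Over a local ring the socle is a vector space over the residue field, with
`(a mod 𝔪) • x = a • x`. -/
noncomputable instance (A L : Type*) [CommRing A] [IsLocalRing A] [AddCommGroup L]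
    [Module A L] : Module (IsLocalRing.ResidueField A) (socle A L) :=
  (socle_isTorsionBySet A L).module

variable {R M : Type*} [CommRing R] [AddCommGroup M] [Module R M]

/-- `p` is an embedded associated prime of `N`: it belongs to `Ass (M / N)` and is not minimal
there. -/
def IsEmbeddedPrime (N : Submodule R M) (p : Ideal R) : Prop :=
  p ∈ associatedPrimes R (M ⧸ N) ∧ ∃ q ∈ associatedPrimes R (M ⧸ N), q < p

/-- `Q` is a `p`-primary submodule of `M`. -/
def IsPrimaryAt (p : Ideal R) (Q : Submodule R M) : Prop :=
  Q.IsPrimary ∧ (Q.colon Set.univ).radical = p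

/-- The set `⋀_p(N)` of `p`-primary components of `N`: the `p`-primary submodules which appear in
some irredundant primary decomposition of `N`. -/
def primaryComponents (p : Ideal R) (N : Submodule R M) : Set (Submodule R M) :=
  {Q | IsPrimaryAt p Q ∧ ∃ t : Finset (Submodule R M), N.IsMinimalPrimaryDecomposition t ∧ Q ∈ t}

/-- `Q` is a `p`-maximal embedded component of `N`: a maximal element, with respect to inclusion,
of the set of `p`-primary components of `N`. -/
def IsMaximalComponent (p : Ideal R) (N Q : Submodule R M) : Prop :=
  Maximal (· ∈ primaryComponents p N) Q

/-- `s` is an irredundant irreducible decomposition of `L`. -/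
structure IsIrredundantIrreducibleDecomposition (L : Submodule R M)
    (s : Finset (Submodule R M)) : Prop where
  inf_eq : s.inf id = L
  irreducible : ∀ ⦃J⦄, J ∈ s → InfIrred J
  irredundant : ∀ ⦃J⦄, J ∈ s → ¬ (s.erase J).inf id ≤ J

/-- The set `IC_p(L)` of irreducible `p`-primary submodules which appear in some irredundant
irreducible decomposition of `L`. -/
def irreducibleComponents (p : Ideal R) (L : Submodule R M) : Set (Submodule R M) :=
  {Q | IsPrimaryAt p Q ∧
    ∃ s : Finset (Submodule R M), IsIrredundantIrreducibleDecomposition L s ∧ Q ∈ s}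

/-- The number of `p`-primary members of a finite set of submodules. -/
noncomputable def countAt (p : Ideal R) (s : Finset (Submodule R M)) : ℕ :=
  {Q : Submodule R M | Q ∈ s ∧ IsPrimaryAt p Q}.ncard

/-- `ir_p(L)`: the number of `p`-primary members of an irredundant irreducible decomposition
of `L`. The infimum picks a decomposition for which this number is smallest; that the number is the
same for every decomposition is not part of the definition. -/
noncomputable def irAt (p : Ideal R) (L : Submodule R M) : ℕ :=
  sInf {n | ∃ s : Finset (Submodule R M),
    IsIrredundantIrreducibleDecomposition L s ∧ countAt p s = n}

/-- Irredundant irreducible decompositions exist, so that `irAt` is attained. -/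
theorem exists_isIrredundantIrreducibleDecomposition [IsNoetherian R M] (L : Submodule R M) :
    ∃ s, IsIrredundantIrreducibleDecomposition L s := by
  obtain ⟨s, hs, hirr⟩ := exists_infIrred_decomposition L
  obtain ⟨t, hts, ht, hmin⟩ := Submodule.decomposition_erase_inf hs
  exact ⟨t, ht, fun J hJ => hirr (hts hJ), hmin⟩

end IndexOfReducibility

/-! Everything is read off from the socle of `(M ⧸ N)_p`. Let `N = ⋂ J` be an irredundant
irreducible decomposition. The natural map from `Soc (M ⧸ N)_p` to the product of the `Soc (M ⧸
J)_p` over the `p`-primary `J` is an isomorphism. It is injective because the other members have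
zero socle at `p`. It is surjective because irredundancy gives an element of all the other members
whose annihilator modulo `J` is `p`, and each factor is a line by irreducibility. So the number of
`p`-primary members is the dimension of the socle (`countAt_eq_rank`).

For (ii), let `Q` be the intersection of the `p`-primary members. It is a `p`-primary component with
the same count as `N`, so `Soc (M ⧸ N)_p → Soc (M ⧸ Q)_p`, being injective, is bijective. If a
component `Q'` contains `Q`, then `Soc (M ⧸ Q)_p → Soc (M ⧸ Q')_p` is injective, which forces `Q =
Q'`; hence `Q` is maximal.

Conversely, a decomposition of a maximal `Q` is joined to one of the intersection of the remaining
primary components, then pruned. No member coming from `Q` can be lost, since the rest would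
intersect in a larger `p`-primary component (`exists_decomposition`). This also gives equality of
the indices in (i). -/

namespace IndexOfReducibility

/-! ### Socles over a local ring -/

section Socle

variable {A L K : Type*} [CommRing A] [IsLocalRing A] [AddCommGroup L] [Module A L]
  [AddCommGroup K] [Module A K]

/-- Over a local ring the socle consists of the elements killed by the maximal ideal. -/
theorem mem_socle_iff {x : L} :
    x ∈ socle A L ↔ ∀ a ∈ IsLocalRing.maximalIdeal A, a • x = 0 := by
  refine ⟨fun hx a ha => congrArg Subtype.val (@socle_isTorsionBySet A L _ _ _ _ ⟨x, hx⟩ ⟨a, ha⟩),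
    fun hx => ?_⟩
  by_cases h0 : x = 0
  · simp [h0]
  have hker : LinearMap.ker (LinearMap.toSpanSingleton A L x) = IsLocalRing.maximalIdeal A := by
    refine ((IsLocalRing.maximalIdeal.isMaximal A).eq_of_le ?_ fun a ha => ?_).symm
    · rw [Ne, Ideal.eq_top_iff_one]
      simpa using h0
    · simpa using hx a ha
  have hsimple : IsSimpleModule A (Submodule.span A {x}) := by
    rw [← LinearMap.range_toSpanSingleton, isSimpleModule_iff_quot_maximal]
    refine ⟨IsLocalRing.maximalIdeal A, inferInstance, ⟨?_⟩⟩
    exact (LinearMap.quotKerEquivRange _).symm.trans (Submodule.quotEquivOfEq _ _ hker)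
  exact le_sSup (a := Submodule.span A {x}) hsimple (Submodule.mem_span_singleton_self x)

theorem residue_smul_socle (a : A) (x : socle A L) :
    (IsLocalRing.residue A a : IsLocalRing.ResidueField A) • x = a • x := rfl

theorem map_mem_socle (f : L →ₗ[A] K) {x : L} (hx : x ∈ socle A L) : f x ∈ socle A K := by
  rw [mem_socle_iff] at hx ⊢
  intro a ha
  rw [← map_smul, hx a ha, map_zero]

/-- The map induced on socles by a linear map, as a map of vector spaces over the residue
field. -/
def socleMap (f : L →ₗ[A] K) :
    socle A L →ₗ[IsLocalRing.ResidueField A] socle A K where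
  toFun x := ⟨f x, map_mem_socle f x.2⟩
  map_add' x y := Subtype.ext (map_add f x.1 y.1)
  map_smul' c x := by
    obtain ⟨a, rfl⟩ := IsLocalRing.residue_surjective c
    exact Subtype.ext (map_smul f a x.1)

@[simp]
theorem coe_socleMap (f : L →ₗ[A] K) (x : socle A L) : (socleMap f x : K) = f x := rfl

end Socle

/-! ### Socles of localized modules -/

section Localization

variable {R X : Type*} [CommRing R] [AddCommGroup X] [Module R X] {p : Ideal R} [p.IsPrime]

theorem localizedModule_mk_eq_zero_iff {m : X} {s : p.primeCompl} :
    LocalizedModule.mk m s = 0 ↔ ∃ u ∉ p, u • m = 0 := by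
  rw [← LocalizedModule.zero_mk s, LocalizedModule.mk_eq]
  constructor
  · rintro ⟨u, hu⟩
    refine ⟨u * s, (u * s).2, ?_⟩
    simpa [Submonoid.smul_def, mul_smul] using hu
  · rintro ⟨u, hu, h⟩
    refine ⟨⟨u, hu⟩, ?_⟩
    simp only [Submonoid.smul_def, smul_zero]
    rw [smul_comm, h, smul_zero]

theorem mem_socle_localizedModule_iff {x : LocalizedModule p.primeCompl X} :
    x ∈ socle (Localization.AtPrime p) (LocalizedModule p.primeCompl X) ↔
      ∀ r ∈ p, r • x = 0 := by
  rw [mem_socle_iff]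
  constructor
  · intro h r hr
    rw [← algebraMap_smul (Localization.AtPrime p) r x]
    refine h _ ?_
    rwa [← IsLocalization.AtPrime.to_map_mem_maximal_iff (Localization.AtPrime p) p r] at hr
  · intro h a ha
    rw [← Localization.AtPrime.map_eq_maximalIdeal] at ha
    refine Submodule.span_induction (p := fun a _ => a • x = 0) ?_ (zero_smul _ _) ?_ ?_ ha
    · rintro _ ⟨r, hr, rfl⟩
      rw [algebraMap_smul]
      exact h r hr
    · intro a b _ _ ha hb
      rw [add_smul, ha, hb, add_zero]
    · intro a b _ hb
      rw [smul_assoc, hb, smul_zero]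

/-- A nonzero socle element has the maximal ideal as annihilator, so that ideal is associated to the
localization, and associated primes contract along localization. -/
theorem mem_associatedPrimes_of_socle_ne_zero [IsNoetherianRing R]
    {x : LocalizedModule p.primeCompl X}
    (hx : x ∈ socle (Localization.AtPrime p) (LocalizedModule p.primeCompl X)) (h0 : x ≠ 0) :
    p ∈ associatedPrimes R X := by
  have hmax : IsLocalRing.maximalIdeal (Localization.AtPrime p) ∈
      associatedPrimes (Localization.AtPrime p) (LocalizedModule p.primeCompl X) := by
    refine ⟨inferInstance, x, ?_⟩
    have : (⊥ : Submodule (Localization.AtPrime p) (LocalizedModule p.primeCompl X)).colon {x} =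
        IsLocalRing.maximalIdeal (Localization.AtPrime p) := by
      refine ((IsLocalRing.maximalIdeal.isMaximal _).eq_of_le ?_ fun a ha => ?_).symm
      · rw [Ne, Ideal.eq_top_iff_one, Submodule.mem_colon_singleton]
        simpa using h0
      · rw [Submodule.mem_colon_singleton]
        simpa using mem_socle_iff.1 hx a ha
    rw [this, Ideal.IsPrime.radical inferInstance]
  have h := open Module.associatedPrimes in
    comap_mem_associatedPrimes_of_mem_associatedPrimes_of_isLocalizedModule_of_fg
    p.primeCompl (LocalizedModule.mkLinearMap p.primeCompl X) _ hmax (IsNoetherian.noetherian _)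
  have hunder := Localization.AtPrime.under_maximalIdeal (I := p)
  rw [Ideal.under_def] at hunder
  rwa [hunder] at h

end Localization

/-! ### Primary submodules and annihilators -/

section Primary

variable {R M : Type*} [CommRing R] [AddCommGroup M] [Module R M] {p : Ideal R}
  {J K : Submodule R M}

theorem IsPrimaryAt.mem_of_smul_mem (hJ : IsPrimaryAt p J) {r : R} {m : M} (hr : r ∉ p)
    (h : r • m ∈ J) : m ∈ J :=
  (hJ.1.mem_or_mem h).resolve_right (hJ.2 ▸ hr)

theorem IsPrimaryAt.eq_of_mem_associatedPrimes (hJ : IsPrimaryAt p J) {q : Ideal R}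
    (hq : q ∈ associatedPrimes R (M ⧸ J)) : q = p := by
  obtain ⟨hprime, x, rfl⟩ := hq
  obtain ⟨m, rfl⟩ := J.mkQ_surjective x
  have h : (⊥ : Submodule R (M ⧸ J)).colon {J.mkQ m} = J.colon {m} := by
    ext r
    rw [Submodule.mem_colon_singleton, Submodule.mem_colon_singleton, Submodule.mem_bot,
      ← map_smul, Submodule.mkQ_apply, Submodule.Quotient.mk_eq_zero]
  rw [h] at hprime ⊢
  rw [← hJ.2]
  refine hJ.1.radical_colon_singleton_of_notMem fun hm => hprime.ne_top ?_
  rw [Ideal.radical_eq_top, Ideal.eq_top_iff_one, Submodule.mem_colon_singleton, one_smul]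
  exact hm

/-- A submodule not contained in a `p`-primary submodule `J` has an element whose image in `M ⧸ J`
has annihilator `p`. -/
theorem IsPrimaryAt.exists_mem_smul_mem_iff [IsNoetherianRing R] [p.IsPrime]
    (hJ : IsPrimaryAt p J) (hK : ¬ K ≤ J) : ∃ m ∈ K, ∀ r : R, r • m ∈ J ↔ r ∈ p := by
  obtain ⟨x, hxK, hxJ⟩ := SetLike.not_le_iff_exists.1 hK
  have hass : (J.comap K.subtype).IsAssociatedPrime p := by
    refine ⟨inferInstance, ⟨x, hxK⟩, ?_⟩
    rw [← hJ.2, ← hJ.1.radical_colon_singleton_of_notMem hxJ]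
    congr 1
    ext r
    simp [Submodule.mem_colon_singleton]
  -- So far `p` is only the radical of a colon ideal; over a noetherian ring another element has
  -- annihilator exactly `p`.
  obtain ⟨-, ⟨m, hm⟩, h⟩ := Submodule.isAssociatedPrime_iff.1 hass
  refine ⟨m, hm, fun r => ?_⟩
  rw [h, Submodule.mem_colon_singleton]
  rfl

end Primary

/-! ### The socle of `(M ⧸ N)_p` and its functoriality -/

section SocleQuotient

variable {R M : Type*} [CommRing R] [AddCommGroup M] [Module R M] (p : Ideal R) [p.IsPrime]
  {N J K : Submodule R M}

/-- The socle of `(M ⧸ N)_p`. -/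
abbrev socleAt (N : Submodule R M) :
    Submodule (Localization.AtPrime p) (LocalizedModule p.primeCompl (M ⧸ N)) :=
  socle (Localization.AtPrime p) (LocalizedModule p.primeCompl (M ⧸ N))

instance (N : Submodule R M) : Module.Free p.ResidueField (socleAt p N) :=
  Module.Free.of_divisionRing p.ResidueField (socleAt p N)

/-- The map `Soc (M ⧸ N)_p → Soc (M ⧸ J)_p` for `N ≤ J`. -/
noncomputable def socleFactor (h : N ≤ J) :
    socleAt p N →ₗ[p.ResidueField] socleAt p J :=
  socleMap (LocalizedModule.map p.primeCompl (Submodule.factor h))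

variable {p}

theorem socleFactor_apply_mk (h : N ≤ J) {m : M} {s : p.primeCompl}
    (hm : LocalizedModule.mk (N.mkQ m) s ∈ socleAt p N) :
    (socleFactor p h ⟨_, hm⟩ : LocalizedModule p.primeCompl (M ⧸ J)) =
      LocalizedModule.mk (J.mkQ m) s := by
  simp [socleFactor, LocalizedModule.map_mk]

theorem socleFactor_socleFactor (h : N ≤ J) (h' : J ≤ K) (x : socleAt p N) :
    socleFactor p h' (socleFactor p h x) = socleFactor p (h.trans h') x := by
  obtain ⟨x, hx⟩ := x
  induction x using LocalizedModule.induction_on with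
  | _ m s =>
  obtain ⟨m, rfl⟩ := N.mkQ_surjective m
  refine Subtype.ext ?_
  simp [socleFactor, LocalizedModule.map_mk]

theorem mk_mkQ_eq_zero_iff {m : M} {s : p.primeCompl} :
    LocalizedModule.mk (N.mkQ m) s = 0 ↔ ∃ u ∉ p, u • m ∈ N := by
  rw [localizedModule_mk_eq_zero_iff]
  refine exists_congr fun u => and_congr_right fun _ => ?_
  rw [← map_smul, Submodule.mkQ_apply, Submodule.Quotient.mk_eq_zero]

theorem IsPrimaryAt.mk_mkQ_eq_zero_iff_mem (hJ : IsPrimaryAt p J) {m : M} {s : p.primeCompl} :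
    LocalizedModule.mk (J.mkQ m) s = 0 ↔ m ∈ J := by
  rw [mk_mkQ_eq_zero_iff]
  refine ⟨fun ⟨u, hu, h⟩ => hJ.mem_of_smul_mem hu h, fun h => ⟨1, ?_, by simpa using h⟩⟩
  exact p.primeCompl.one_mem

theorem mk_mkQ_mem_socleAt {m : M} (h : ∀ r ∈ p, r • m ∈ N) (s : p.primeCompl) :
    LocalizedModule.mk (N.mkQ m) s ∈ socleAt p N := by
  rw [mem_socle_localizedModule_iff]
  intro r hr
  rw [LocalizedModule.smul'_mk, ← map_smul, Submodule.mkQ_apply,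
    (Submodule.Quotient.mk_eq_zero N).2 (h r hr), LocalizedModule.zero_mk]

/-- An element of `Soc (M ⧸ N)_p` which vanishes in `(M ⧸ J)_p` for every `J` in a finite
decomposition of `N` is zero. -/
theorem eq_zero_of_socleFactor_eq_zero {s : Finset (Submodule R M)} (hs : s.inf id = N)
    (hle : ∀ J ∈ s, N ≤ J) {x : socleAt p N}
    (hx : ∀ J (hJ : J ∈ s), socleFactor p (hle J hJ) x = 0) : x = 0 := by
  obtain ⟨x, hx'⟩ := x
  induction x using LocalizedModule.induction_on with
  | _ m t =>
  obtain ⟨m, rfl⟩ := N.mkQ_surjective m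
  refine Subtype.ext (mk_mkQ_eq_zero_iff.2 ?_)
  have key : ∀ J : s, ∃ u ∉ p, u • m ∈ (J : Submodule R M) := fun J =>
    mk_mkQ_eq_zero_iff.1
      ((socleFactor_apply_mk (hle J J.2) hx').symm.trans (congrArg Subtype.val (hx J J.2)))
  choose u hup hum using key
  -- One multiplier for all members at once: the product stays outside the prime `p`.
  refine ⟨∏ J, u J, p.primeCompl.prod_mem fun J _ => hup J, ?_⟩
  rw [← hs, Submodule.mem_finsetInf]
  intro J hJ
  rw [← Finset.prod_erase_mul _ _ (Finset.mem_univ (⟨J, hJ⟩ : s)), mul_smul]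
  exact J.smul_mem _ (hum ⟨J, hJ⟩)

variable [IsNoetherianRing R]

/-- If `J` is primary with radical different from `p` then `(M ⧸ J)_p` has trivial socle. -/
theorem subsingleton_socleAt {q : Ideal R} (hJ : IsPrimaryAt q J) (hq : q ≠ p) :
    Subsingleton (socleAt p J) := by
  refine subsingleton_of_forall_eq 0 fun x => ?_
  by_contra h0
  refine hq (hJ.eq_of_mem_associatedPrimes
    (mem_associatedPrimes_of_socle_ne_zero x.2 fun h => h0 (Subtype.ext h))).symm

/-- If `J` is `p`-primary and `Soc (M ⧸ J)_p → Soc (M ⧸ K)_p` is injective then `J = K`. -/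
theorem IsPrimaryAt.eq_of_socleFactor_injective (hJ : IsPrimaryAt p J) (h : J ≤ K)
    (hinj : Function.Injective (socleFactor p h)) : J = K := by
  by_contra hne
  obtain ⟨m, hmK, hm⟩ := hJ.exists_mem_smul_mem_iff fun h' => hne (le_antisymm h h')
  have hsoc : LocalizedModule.mk (J.mkQ m) (1 : p.primeCompl) ∈ socleAt p J :=
    mk_mkQ_mem_socleAt (fun r hr => (hm r).2 hr) 1
  have h0 : (⟨_, hsoc⟩ : socleAt p J) = 0 := by
    refine hinj ?_
    rw [map_zero]
    refine Subtype.ext ((socleFactor_apply_mk h hsoc).trans ?_)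
    exact mk_mkQ_eq_zero_iff.2 ⟨1, p.primeCompl.one_mem, K.smul_mem 1 hmK⟩
  have h1 := hJ.mk_mkQ_eq_zero_iff_mem.1 (congrArg Subtype.val h0)
  exact p.primeCompl.one_mem ((hm 1).1 (J.smul_mem 1 h1))

/-- If `J` is irreducible and `p`-primary then `Soc (M ⧸ J)_p` is one-dimensional. -/
theorem IsPrimaryAt.rank_socleAt_eq_one (hJ : IsPrimaryAt p J) (hirr : InfIrred J) :
    Module.rank p.ResidueField (socleAt p J) = 1 := by
  obtain ⟨m, -, hm⟩ := hJ.exists_mem_smul_mem_iff (K := ⊤) fun h => hJ.1.ne_top (top_le_iff.1 h)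
  have hmJ : m ∉ J := fun h => p.primeCompl.one_mem ((hm 1).1 (J.smul_mem 1 h))
  refine rank_eq_one_iff.2
    ⟨⟨_, mk_mkQ_mem_socleAt (fun r hr => (hm r).2 hr) 1⟩, ?_, ?_⟩
  · exact fun h => hmJ (hJ.mk_mkQ_eq_zero_iff_mem.1 (congrArg Subtype.val h))
  intro ⟨w, hw⟩
  induction w using LocalizedModule.induction_on with
  | _ n t =>
  obtain ⟨n, rfl⟩ := J.mkQ_surjective n
  by_cases hn : n ∈ J
  · refine ⟨0, ?_⟩
    rw [zero_smul]
    exact Subtype.ext (hJ.mk_mkQ_eq_zero_iff_mem.2 hn).symm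
  -- Irreducibility: two submodules strictly above `J` meet outside `J`. A common element gives `a •
  -- m ≡ b • n` modulo `J` with `b • n ∉ J`.
  have hlt : ¬ (J ⊔ Submodule.span R {m}) ⊓ (J ⊔ Submodule.span R {n}) ≤ J := by
    intro hle
    rcases hirr.2 (le_antisymm hle (le_inf le_sup_left le_sup_left)) with h | h
    · exact hmJ (h ▸ Submodule.mem_sup_right (Submodule.mem_span_singleton_self m))
    · exact hn (h ▸ Submodule.mem_sup_right (Submodule.mem_span_singleton_self n))
  obtain ⟨z, ⟨hz₁, hz₂⟩, hz⟩ := SetLike.not_le_iff_exists.1 hlt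
  obtain ⟨j₁, hj₁, _, hy₁, rfl⟩ := Submodule.mem_sup.1 hz₁
  obtain ⟨a, rfl⟩ := Submodule.mem_span_singleton.1 hy₁
  obtain ⟨j₂, hj₂, _, hy₂, hab⟩ := Submodule.mem_sup.1 hz₂
  obtain ⟨b, rfl⟩ := Submodule.mem_span_singleton.1 hy₂
  have hsub : a • m - b • n ∈ J := by
    have : a • m - b • n = j₂ - j₁ := by
      rw [sub_eq_sub_iff_add_eq_add, add_comm, ← hab]
    rw [this]
    exact J.sub_mem hj₂ hj₁
  have hbn : b • n ∉ J := fun h => hz (J.add_mem hj₁ ((J.sub_mem_iff_left h).1 hsub))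
  -- The class of `n / t` lies in the socle, so `b ∈ p` would kill it.
  have hb : b ∉ p := by
    intro hb
    have h := mem_socle_localizedModule_iff.1 hw b hb
    rw [LocalizedModule.smul'_mk, ← map_smul, hJ.mk_mkQ_eq_zero_iff_mem] at h
    exact hbn h
  have heq : J.mkQ (a • m) = J.mkQ (b • n) := (Submodule.Quotient.eq J).2 hsub
  -- With `b` invertible, `n / t = (a / (b t)) • m` modulo `J`.
  refine ⟨IsLocalRing.residue _ (Localization.mk a (⟨b, hb⟩ * t)), ?_⟩
  rw [residue_smul_socle]
  refine Subtype.ext ?_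
  change Localization.mk a (⟨b, hb⟩ * t) • LocalizedModule.mk (J.mkQ m) 1 = _
  rw [LocalizedModule.mk_smul_mk, ← map_smul, heq, map_smul, mul_one]
  exact LocalizedModule.mk_cancel_common_left ⟨b, hb⟩ t (J.mkQ n)

end SocleQuotient

/-! ### Counting irreducible components by socle dimension -/

section Count

variable {R M : Type*} [CommRing R] [AddCommGroup M] [Module R M] {p : Ideal R}
  {N Q : Submodule R M} {s : Finset (Submodule R M)}

theorem IsIrredundantIrreducibleDecomposition.le
    (hs : IsIrredundantIrreducibleDecomposition N s) {J : Submodule R M} (hJ : J ∈ s) : N ≤ J :=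
  hs.inf_eq ▸ Finset.inf_le (f := id) hJ

theorem IsIrredundantIrreducibleDecomposition.filter
    [DecidablePred (IsPrimaryAt (M := M) p)]
    (hs : IsIrredundantIrreducibleDecomposition N s) :
    IsIrredundantIrreducibleDecomposition ((s.filter (IsPrimaryAt p)).inf id)
      (s.filter (IsPrimaryAt p)) := by
  refine ⟨rfl, fun J hJ => hs.irreducible (Finset.mem_filter.1 hJ).1, fun J hJ hle => ?_⟩
  refine hs.irredundant (Finset.mem_filter.1 hJ).1 (le_trans (Finset.inf_mono ?_) hle)
  exact Finset.erase_subset_erase _ (Finset.filter_subset _ _)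

variable [IsNoetherianRing R] [Module.Finite R M]

/-- The number of `p`-primary members of an irredundant irreducible decomposition of `N` is the
dimension of `Soc (M ⧸ N)_p`. -/
theorem IsIrredundantIrreducibleDecomposition.countAt_eq_rank [p.IsPrime]
    (hs : IsIrredundantIrreducibleDecomposition N s) :
    (countAt p s : Cardinal) = Module.rank p.ResidueField (socleAt p N) := by
  classical
  let ι := {J : Submodule R M // J ∈ s ∧ IsPrimaryAt p J}
  have hfin : Finite ι := (s.finite_toSet.subset fun J hJ => hJ.1 :
    {J : Submodule R M | J ∈ s ∧ IsPrimaryAt p J}.Finite)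
  have := Fintype.ofFinite ι
  let Φ : socleAt p N →ₗ[p.ResidueField] ((J : ι) → socleAt p J.1) :=
    LinearMap.pi fun J => socleFactor p (hs.le J.2.1)
  have hinj : Function.Injective Φ := by
    intro x y hxy
    rw [← sub_eq_zero]
    refine eq_zero_of_socleFactor_eq_zero hs.inf_eq (fun J hJ => hs.le hJ) fun J hJ => ?_
    by_cases hJp : IsPrimaryAt p J
    · rw [map_sub, sub_eq_zero]
      exact congrFun hxy ⟨J, hJ, hJp⟩
    · have hJ' : IsPrimaryAt (J.colon Set.univ).radical J := ⟨(hs.irreducible hJ).isPrimary, rfl⟩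
      have := subsingleton_socleAt hJ' fun h => hJp ⟨hJ'.1, h⟩
      exact Subsingleton.elim _ _
  have hsurj : Function.Surjective Φ := by
    rw [← LinearMap.range_eq_top, eq_top_iff]
    intro y _
    have hsum : ∑ J : ι, Pi.single J (y J) = y := Finset.univ_sum_single y
    rw [← hsum]
    refine Submodule.sum_mem _ fun J _ => ?_
    -- The class of `m` spans the line at `J` and vanishes in every other factor.
    obtain ⟨m, hmK, hm⟩ := J.2.2.exists_mem_smul_mem_iff (hs.irredundant J.2.1)
    have hmN : ∀ r ∈ p, r • m ∈ N := by
      intro r hr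
      rw [← hs.inf_eq, ← Finset.insert_erase J.2.1, Finset.inf_insert]
      exact ⟨(hm r).2 hr, Submodule.smul_mem _ _ hmK⟩
    let x : socleAt p N := ⟨_, mk_mkQ_mem_socleAt hmN 1⟩
    have hne : socleFactor p (hs.le J.2.1) x ≠ 0 := fun h => by
      have h0 := J.2.2.mk_mkQ_eq_zero_iff_mem.1
        ((socleFactor_apply_mk _ (mk_mkQ_mem_socleAt hmN 1)).symm.trans (congrArg Subtype.val h))
      exact p.primeCompl.one_mem ((hm 1).1 (Submodule.smul_mem _ 1 h0))
    obtain ⟨c, hc⟩ := exists_smul_eq_of_finrank_eq_one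
      (Module.rank_eq_one_iff_finrank_eq_one.1
        (J.2.2.rank_socleAt_eq_one (hs.irreducible J.2.1))) hne (y J)
    refine ⟨c • x, funext fun J' => ?_⟩
    by_cases hJJ : J' = J
    · subst hJJ
      rw [Pi.single_eq_same, map_smul]
      exact hc
    · rw [Pi.single_eq_of_ne hJJ, map_smul]
      have h0 : socleFactor p (hs.le J'.2.1) x = 0 := by
        refine Subtype.ext ((socleFactor_apply_mk _ (mk_mkQ_mem_socleAt hmN 1)).trans ?_)
        refine J'.2.2.mk_mkQ_eq_zero_iff_mem.2 ?_
        exact (Submodule.mem_finsetInf.1 hmK) J'.1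
          (Finset.mem_erase.2 ⟨fun h => hJJ (Subtype.ext h), J'.2.1⟩)
      change c • socleFactor p (hs.le J'.2.1) x = 0
      rw [h0, smul_zero]
  rw [(LinearEquiv.ofBijective Φ ⟨hinj, hsurj⟩).rank_eq, rank_pi]
  have hone : ∀ J : ι, Module.rank p.ResidueField (socleAt p J.1) = 1 := fun J =>
    J.2.2.rank_socleAt_eq_one (hs.irreducible J.2.1)
  simp only [hone]
  have hcard : countAt p s = Fintype.card ι := by
    rw [countAt, ← Nat.card_coe_set_eq, ← Nat.card_eq_fintype_card]
    rfl
  simp [hcard]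

theorem IsIrredundantIrreducibleDecomposition.countAt_eq_irAt [p.IsPrime]
    (hs : IsIrredundantIrreducibleDecomposition N s) : countAt p s = irAt p N := by
  obtain ⟨t, ht, hcount⟩ := Nat.sInf_mem
    (s := {n | ∃ s, IsIrredundantIrreducibleDecomposition N s ∧ countAt p s = n}) ⟨_, s, hs, rfl⟩
  change countAt p s = sInf _
  rw [← hcount]
  exact_mod_cast hs.countAt_eq_rank.trans ht.countAt_eq_rank.symm

theorem irAt_eq_rank [p.IsPrime] (N : Submodule R M) :
    (irAt p N : Cardinal) = Module.rank p.ResidueField (socleAt p N) := by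
  obtain ⟨s, hs⟩ := exists_isIrredundantIrreducibleDecomposition N
  rw [← hs.countAt_eq_irAt, hs.countAt_eq_rank]

theorem finite_socleAt [p.IsPrime] (N : Submodule R M) :
    Module.Finite p.ResidueField (socleAt p N) := by
  rw [← Module.rank_lt_aleph0_iff, ← irAt_eq_rank]
  exact Cardinal.natCast_lt_aleph0

end Count

/-! ### Maximal components and irreducible decompositions -/

section Components

variable {R M : Type*} [CommRing R] [AddCommGroup M] [Module R M] {p : Ideal R}
  {N Q : Submodule R M} {s : Finset (Submodule R M)}

theorem isPrimaryAt_finsetInf (hne : s.Nonempty) (hs : ∀ J ∈ s, IsPrimaryAt p J) :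
    IsPrimaryAt p (s.inf id) := by
  obtain ⟨J, hJ⟩ := hne
  refine ⟨Submodule.isPrimary_finsetInf hJ (fun K hK => (hs K hK).1)
    fun K hK => (hs K hK).2.trans (hs J hJ).2.symm, ?_⟩
  rw [Submodule.colon_finsetInf, Ideal.radical_finset_inf (f := fun K => (id K).colon Set.univ) hJ
    fun K hK => (hs K hK).2.trans (hs J hJ).2.symm]
  exact (hs J hJ).2

/-- In a minimal primary decomposition, a member may be replaced by a larger primary submodule
with the same radical, as long as the intersection does not change. -/
theorem isMinimalPrimaryDecomposition_insert_erase
    {t : Finset (Submodule R M)} (ht : N.IsMinimalPrimaryDecomposition t)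
    (hQt : Q ∈ t) (hQ : IsPrimaryAt p Q) {Q' : Submodule R M} (hQ' : IsPrimaryAt p Q')
    (hle : Q ≤ Q') (hinf : Q' ⊓ (t.erase Q).inf id ≤ N) :
    N.IsMinimalPrimaryDecomposition (insert Q' (t.erase Q)) := by
  have hrad : ∀ J ∈ t.erase Q, (J.colon Set.univ).radical ≠ p := fun J hJ h =>
    ht.distinct (Finset.mem_of_mem_erase hJ) hQt (Finset.ne_of_mem_erase hJ) (h.trans hQ.2.symm)
  have hN : N = Q ⊓ (t.erase Q).inf id := by
    rw [← ht.inf_eq]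
    conv_lhs => rw [← Finset.insert_erase hQt, Finset.inf_insert]
    rfl
  have hnot : Q' ∉ t.erase Q := fun h => hrad Q' h hQ'.2
  refine ⟨?_, ?_, ?_, ?_⟩
  · rw [Finset.inf_insert]
    exact le_antisymm hinf (hN.le.trans (inf_le_inf_right _ hle))
  · intro J hJ
    rcases Finset.mem_insert.1 hJ with rfl | hJ
    · exact hQ'.1
    · exact ht.primary (Finset.mem_of_mem_erase hJ)
  · rw [Finset.coe_insert]
    have : Std.Symm (Function.onFun (· ≠ ·)
        fun J : Submodule R M => (J.colon Set.univ).radical) := ⟨fun _ _ h => Ne.symm h⟩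
    refine Set.pairwise_insert_of_symm.2
      ⟨ht.distinct.mono (Finset.coe_subset.2 (Finset.erase_subset _ _)), fun J hJ _ h => ?_⟩
    exact hrad J hJ (h.symm.trans hQ'.2)
  · intro J hJ
    rcases Finset.mem_insert.1 hJ with rfl | hJt
    · rw [Finset.erase_insert hnot]
      intro h
      -- If `Q'` contained the intersection of the others, that intersection would lie in `N ≤ Q`,
      -- so `Q` was already redundant.
      exact ht.minimal hQt ((le_inf h le_rfl).trans (hinf.trans (hN.le.trans inf_le_left)))
    · intro h
      refine ht.minimal (Finset.mem_of_mem_erase hJt) (le_trans ?_ h)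
      have hJQ : Q ≠ J := (Finset.ne_of_mem_erase hJt).symm
      have hJQ' : Q' ≠ J := fun h => hnot (h ▸ hJt)
      rw [Finset.erase_insert_of_ne hJQ', Finset.inf_insert, Finset.erase_right_comm]
      exact le_inf ((Finset.inf_le (f := id) (Finset.mem_erase.2 ⟨hJQ, hQt⟩)).trans hle)
        (Finset.inf_mono (Finset.erase_subset _ _))

variable [IsNoetherianRing R]

/-- If `K` is the intersection of the members other than the `p`-primary one of a minimal primary
decomposition, then `Soc (M ⧸ K)_p` is trivial. -/
theorem subsingleton_socleAt_inf_erase [p.IsPrime]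
    {t : Finset (Submodule R M)}
    (ht : N.IsMinimalPrimaryDecomposition t) (hQt : Q ∈ t) (hQ : IsPrimaryAt p Q) :
    Subsingleton (socleAt p ((t.erase Q).inf id)) := by
  refine subsingleton_of_forall_eq 0 fun x => ?_
  refine eq_zero_of_socleFactor_eq_zero rfl (fun J hJ => Finset.inf_le (f := id) hJ)
    fun J hJ => ?_
  have hJt := Finset.mem_of_mem_erase hJ
  have := subsingleton_socleAt (p := p) (J := J) ⟨ht.primary hJt, rfl⟩ fun h =>
    ht.distinct hJt hQt (Finset.ne_of_mem_erase hJ) (h.trans hQ.2.symm)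
  exact Subsingleton.elim _ _

/-- Write `N = Q ⊓ K` with `K` the intersection of the other components; `K` has no socle at `p`, so
`Q` alone detects the socle. -/
theorem socleFactor_injective_of_mem_primaryComponents [p.IsPrime]
    (hQ : Q ∈ primaryComponents p N) (hle : N ≤ Q) :
    Function.Injective (socleFactor p hle) := by
  classical
  obtain ⟨hQp, t, ht, hQt⟩ := hQ
  have hN : ({Q, (t.erase Q).inf id} : Finset (Submodule R M)).inf id = N := by
    rw [← ht.inf_eq, Finset.inf_insert, Finset.inf_singleton]
    conv_rhs => rw [← Finset.insert_erase hQt, Finset.inf_insert]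
    rfl
  have := subsingleton_socleAt_inf_erase ht hQt hQp
  refine (injective_iff_map_eq_zero _).2 fun x hx => ?_
  refine eq_zero_of_socleFactor_eq_zero hN (fun J hJ => hN ▸ Finset.inf_le (f := id) hJ)
    fun J hJ => ?_
  rcases Finset.mem_insert.1 hJ with rfl | hJ
  · exact hx
  · obtain rfl := Finset.mem_singleton.1 hJ
    exact Subsingleton.elim _ _

variable [Module.Finite R M]

/-- All members of an irredundant irreducible decomposition of a `p`-primary submodule are
`p`-primary. -/
theorem IsIrredundantIrreducibleDecomposition.isPrimaryAt (hQ : IsPrimaryAt p Q)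
    (hs : IsIrredundantIrreducibleDecomposition Q s) {J : Submodule R M} (hJ : J ∈ s) :
    IsPrimaryAt p J := by
  classical
  have hJp : IsPrimaryAt (J.colon Set.univ).radical J := ⟨(hs.irreducible hJ).isPrimary, rfl⟩
  have := hJp.1.isPrime_radical_colon
  obtain ⟨m, hmK, hm⟩ := hJp.exists_mem_smul_mem_iff (hs.irredundant hJ)
  -- As `m` lies in all other members, `r • m ∈ Q` iff `r • m ∈ J`; thus the radical of `J` is
  -- associated to `M ⧸ Q`.
  refine ⟨hJp.1, hQ.eq_of_mem_associatedPrimes ?_⟩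
  refine isAssociatedPrime_iff.2 ⟨this, Q.mkQ m, ?_⟩
  ext r
  rw [← hm, Submodule.mem_colon_singleton, Submodule.mem_bot, ← map_smul, Submodule.mkQ_apply,
    Submodule.Quotient.mk_eq_zero, ← hs.inf_eq, ← Finset.insert_erase hJ, Finset.inf_insert]
  exact ⟨fun h => ⟨h, Submodule.smul_mem _ _ hmK⟩, fun h => h.1⟩

/-- An irredundant irreducible decomposition of a `p`-maximal component of `N` extends to one of
`N` by members which are not `p`-primary. -/
theorem IsMaximalComponent.exists_decomposition [p.IsPrime] (hQ : IsMaximalComponent p N Q)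
    (hs : IsIrredundantIrreducibleDecomposition Q s) :
    ∃ w, IsIrredundantIrreducibleDecomposition N w ∧ s ⊆ w ∧
      ∀ J ∈ w, IsPrimaryAt p J → J ∈ s := by
  classical
  obtain ⟨hQp, t, ht, hQt⟩ := hQ.1
  have hN : N = Q ⊓ (t.erase Q).inf id := by
    rw [← ht.inf_eq]
    conv_lhs => rw [← Finset.insert_erase hQt, Finset.inf_insert]
    rfl
  obtain ⟨u, hu⟩ := exists_isIrredundantIrreducibleDecomposition ((t.erase Q).inf id)
  have hup : ∀ J ∈ u, ¬ IsPrimaryAt p J := by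
    intro J hJ hJp
    have := subsingleton_socleAt_inf_erase ht hQt hQp
    have h0 : countAt p u = 0 := by
      have := hu.countAt_eq_rank (p := p)
      rw [rank_subsingleton'] at this
      exact_mod_cast this
    rw [countAt, Set.ncard_eq_zero (u.finite_toSet.subset fun J hJ => hJ.1)] at h0
    exact (h0 ▸ (⟨hJ, hJp⟩ : J ∈ {J | J ∈ u ∧ IsPrimaryAt p J}) : J ∈ (∅ : Set _))
  have hsu : (s ∪ u).inf id = N := by
    rw [Finset.inf_union, hs.inf_eq, hu.inf_eq, ← hN]
  obtain ⟨w, hwsu, hw, hirr⟩ := Submodule.decomposition_erase_inf hsu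
  refine ⟨w, ⟨hw, fun J hJ => ?_, hirr⟩, fun J hJ => ?_, fun J hJ hJp => ?_⟩
  · rcases Finset.mem_union.1 (hwsu hJ) with h | h
    exacts [hs.irreducible h, hu.irreducible h]
  · by_contra hJw
    have hsub : w ⊆ s.erase J ∪ u := by
      intro K hK
      rcases Finset.mem_union.1 (hwsu hK) with h | h
      · exact Finset.mem_union_left _ (Finset.mem_erase.2 ⟨fun e => hJw (e ▸ hK), h⟩)
      · exact Finset.mem_union_right _ h
    have hinf : (s.erase J).inf id ⊓ (t.erase Q).inf id ≤ N := by
      rw [← hw, ← hu.inf_eq, ← Finset.inf_union]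
      exact Finset.inf_mono hsub
    -- The empty intersection is `⊤`, which is not primary; in that case `Q` itself would be
    -- redundant in `t`.
    rcases (s.erase J).eq_empty_or_nonempty with he | hne
    · rw [he, Finset.inf_empty, top_inf_eq] at hinf
      exact ht.minimal hQt (hinf.trans (hN.le.trans inf_le_left))
    · have hQ' : IsPrimaryAt p ((s.erase J).inf id) := isPrimaryAt_finsetInf hne fun K hK =>
        hs.isPrimaryAt hQp (Finset.mem_of_mem_erase hK)
      have hle : Q ≤ (s.erase J).inf id := by
        rw [← hs.inf_eq]
        exact Finset.inf_mono (Finset.erase_subset _ _)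
      have hmem : (s.erase J).inf id ∈ primaryComponents p N :=
        ⟨hQ', _, isMinimalPrimaryDecomposition_insert_erase ht hQt hQp hQ' hle hinf,
          Finset.mem_insert_self _ _⟩
      exact hs.irredundant hJ ((hQ.2 hmem hle).trans (hs.le hJ))
  · exact (Finset.mem_union.1 (hwsu hJ)).resolve_right fun h => hup J h hJp

theorem IsMaximalComponent.irAt_eq [p.IsPrime] (hQ : IsMaximalComponent p N Q) :
    irAt p N = irAt p Q := by
  obtain ⟨s, hs⟩ := exists_isIrredundantIrreducibleDecomposition Q
  obtain ⟨w, hw, hsw, hws⟩ := hQ.exists_decomposition hs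
  rw [← hs.countAt_eq_irAt, ← hw.countAt_eq_irAt, countAt, countAt]
  congr 1
  ext J
  exact ⟨fun h => ⟨hws J h.1 h.2, h.2⟩, fun h => ⟨hsw h.1, h.2⟩⟩

/-- The intersection of the `p`-primary members of an irredundant irreducible decomposition of `N`
is a `p`-primary component of `N`. -/
theorem IsIrredundantIrreducibleDecomposition.inf_filter_mem_primaryComponents
    [DecidablePred (IsPrimaryAt (M := M) p)]
    (hs : IsIrredundantIrreducibleDecomposition N s) (hne : (s.filter (IsPrimaryAt p)).Nonempty) :
    (s.filter (IsPrimaryAt p)).inf id ∈ primaryComponents p N := by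
  classical
  -- Grouping the members of `s` by radical gives the primary decomposition.
  let g : Ideal R → Submodule R M := fun q => (s.filter (IsPrimaryAt q)).inf id
  have hg : ∀ J ∈ s, IsPrimaryAt (J.colon Set.univ).radical (g (J.colon Set.univ).radical) :=
    fun J hJ => isPrimaryAt_finsetInf
      ⟨J, Finset.mem_filter.2 ⟨hJ, (hs.irreducible hJ).isPrimary, rfl⟩⟩
      fun K hK => (Finset.mem_filter.1 hK).2
  have hgle : ∀ J ∈ s, g (J.colon Set.univ).radical ≤ J := fun J hJ =>
    Finset.inf_le (f := id) (Finset.mem_filter.2 ⟨hJ, (hs.irreducible hJ).isPrimary, rfl⟩)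
  have hpQ : g p = (s.filter (IsPrimaryAt p)).inf id := by
    simp only [g]
    congr!
  rw [← hpQ]
  obtain ⟨J₀, hJ₀⟩ := hne
  obtain ⟨hJ₀s, hJ₀p⟩ := Finset.mem_filter.1 hJ₀
  refine ⟨hJ₀p.2 ▸ hg J₀ hJ₀s, s.image fun J => g (J.colon Set.univ).radical, ⟨?_, ?_, ?_, ?_⟩,
    Finset.mem_image.2 ⟨J₀, hJ₀s, by rw [hJ₀p.2]⟩⟩
  · rw [Finset.inf_image]
    refine le_antisymm ?_ (Finset.le_inf fun J _ => ?_)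
    · rw [← hs.inf_eq]
      exact Finset.le_inf fun J hJ => (Finset.inf_le hJ).trans (hgle J hJ)
    · rw [← hs.inf_eq]
      exact Finset.inf_mono (Finset.filter_subset _ _)
  · intro K hK
    obtain ⟨J, hJ, rfl⟩ := Finset.mem_image.1 hK
    exact (hg J hJ).1
  · intro K hK K' hK' hne
    obtain ⟨J, hJ, rfl⟩ := Finset.mem_image.1 (Finset.mem_coe.1 hK)
    obtain ⟨J', hJ', rfl⟩ := Finset.mem_image.1 (Finset.mem_coe.1 hK')
    change (Submodule.colon _ _).radical ≠ (Submodule.colon _ _).radical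
    rw [(hg J hJ).2, (hg J' hJ').2]
    exact fun h => hne (by simp only [h])
  · intro K hK hle
    obtain ⟨J, hJ, rfl⟩ := Finset.mem_image.1 hK
    -- The groups with other radicals involve only members different from `J`, so a redundant group
    -- would make `J` redundant.
    refine hs.irredundant hJ (le_trans (Finset.le_inf fun K' hK' => ?_) (hle.trans (hgle J hJ)))
    obtain ⟨hne, hmem⟩ := Finset.mem_erase.1 hK'
    obtain ⟨J', hJ', rfl⟩ := Finset.mem_image.1 hmem
    refine Finset.inf_mono fun L hL => ?_
    obtain ⟨hLs, hLp⟩ := Finset.mem_filter.1 hL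
    refine Finset.mem_erase.2 ⟨?_, hLs⟩
    rintro rfl
    exact hne (by simp only [hLp.2])

/-- The intersection of the `p`-primary members of an irredundant irreducible decomposition of `N`
is a `p`-maximal component of `N`. -/
theorem IsIrredundantIrreducibleDecomposition.isMaximalComponent_inf_filter [p.IsPrime]
    [DecidablePred (IsPrimaryAt (M := M) p)]
    (hs : IsIrredundantIrreducibleDecomposition N s) (hne : (s.filter (IsPrimaryAt p)).Nonempty) :
    IsMaximalComponent p N ((s.filter (IsPrimaryAt p)).inf id) := by
  have hmem := hs.inf_filter_mem_primaryComponents hne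
  refine ⟨hmem, fun Q' hQ' hle => ?_⟩
  set Q := (s.filter (IsPrimaryAt p)).inf id with hQ
  have hNQ : N ≤ Q := by
    rw [← hs.inf_eq]
    exact Finset.inf_mono (Finset.filter_subset _ _)
  have hrank : Module.finrank p.ResidueField (socleAt p N) =
      Module.finrank p.ResidueField (socleAt p Q) := by
    have hcount : countAt p (s.filter (IsPrimaryAt p)) = countAt p s := by
      rw [countAt, countAt]
      congr 1
      ext J
      simp
    have h := hs.filter (p := p)
    rw [Module.finrank, Module.finrank, ← hs.countAt_eq_rank, ← hcount, h.countAt_eq_rank]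
  have := finite_socleAt (p := p) N
  have := finite_socleAt (p := p) Q
  have hsurj : Function.Surjective (socleFactor p hNQ) :=
    (LinearMap.injective_iff_surjective_of_finrank_eq_finrank hrank).1
      (socleFactor_injective_of_mem_primaryComponents hmem hNQ)
  have hinj : Function.Injective (socleFactor p (hNQ.trans hle)) :=
    socleFactor_injective_of_mem_primaryComponents hQ' _
  -- The composite of the socle maps for `N ≤ Q ≤ Q'` is injective and the first is onto, so the
  -- second is injective.
  refine (hmem.1.eq_of_socleFactor_injective hle fun x y hxy => ?_).ge
  obtain ⟨x, rfl⟩ := hsurj x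
  obtain ⟨y, rfl⟩ := hsurj y
  rw [socleFactor_socleFactor, socleFactor_socleFactor] at hxy
  rw [hinj hxy]

theorem irreducibleComponents_eq [p.IsPrime] (N : Submodule R M) :
    irreducibleComponents p N =
      ⋃ Q ∈ {Q | IsMaximalComponent p N Q}, irreducibleComponents p Q := by
  classical
  ext J
  simp only [Set.mem_iUnion, Set.mem_ofPred_eq, exists_prop]
  constructor
  · rintro ⟨hJp, s, hs, hJs⟩
    have hJ := Finset.mem_filter.2 ⟨hJs, hJp⟩
    exact ⟨_, hs.isMaximalComponent_inf_filter ⟨J, hJ⟩, hJp, _, hs.filter, hJ⟩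
  · rintro ⟨Q, hQ, hJp, s, hs, hJs⟩
    obtain ⟨w, hw, hsw, -⟩ := hQ.exists_decomposition hs
    exact ⟨hJp, w, hw, hsw hJs⟩

end Components

end IndexOfReducibility

open IndexOfReducibility in
theorem corollary3p4 {R M : Type*} [CommRing R] [IsNoetherianRing R]
    [AddCommGroup M] [Module R M] [Module.Finite R M]
    (N : Submodule R M) (p : Ideal R) [p.IsPrime] (hp : IsEmbeddedPrime N p) :
    -- `ir_p` is well defined for `N` and for every `p`-maximal embedded component of `N`
    (∀ s, IsIrredundantIrreducibleDecomposition N s → countAt p s = irAt p N) ∧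
    (∀ Q, IsMaximalComponent p N Q →
      ∀ s, IsIrredundantIrreducibleDecomposition Q s → countAt p s = irAt p Q) ∧
    -- (i)
    (∀ Q, IsMaximalComponent p N Q →
      irAt p N = irAt p Q ∧
      (irAt p Q : Cardinal) = Module.rank p.ResidueField
        (socle (Localization.AtPrime p) (LocalizedModule p.primeCompl (M ⧸ N)))) ∧
    -- (ii)
    irreducibleComponents p N =
      ⋃ Q ∈ {Q | IsMaximalComponent p N Q}, irreducibleComponents p Q :=
  ⟨fun _ hs => hs.countAt_eq_irAt, fun _ _ _ hs => hs.countAt_eq_irAt,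
    fun _ hQ => ⟨hQ.irAt_eq, hQ.irAt_eq ▸ irAt_eq_rank N⟩, irreducibleComponents_eq N⟩
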